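/- Let $n\ge 1$ be an integer and $1<p<\infty$. Let $\langle z,w\rangle=\sum_{j=1}^n z_j\overline{w_j}$ and $\|z\|=\langle z,z\rangle^{1/2}$ be the Euclidean inner product and norm on $\mathbb C^n$, let $B_n=\{z\in\mathbb C^n:\|z\|<1\}$, $S_n=\{z\in\mathbb C^n:\|z\|=1\}$, and let $\sigma$ be the rotation-invariant Borel probability measure on $S_n$. The Hardy space $H^p(B_n)$ is the space of holomorphic functions $f:B_n\to\mathbb C$ with $$\|f\|_{H^p(B_n)}:=\sup_{0<r<1}\Big(\int_{S_n}|f(r\zeta)|^p\,d\sigma(\zeta)\Big)^{1/p}<\infty .$$ Theorem. Let $z_0=(z_0^{(1)},\dots,z_0^{(n)})\in B_n$ and $w_0\in\mathbb C$. Among all $f\in H^p(B_n)$ with $f(z_0)=w_0$ there is exactly one, $f_{\min}$, of minimal norm $\|f\|_{H^p(B_n)}$. It is given, for $z=(z_1,\dots,z_n)\in B_n$, by $$f_{\min}(z)=w_0\left(\frac{1-\|z_0\|^2}{1-\langle z,z_0\rangle}\right)^{\frac{2n}{p}}=w_0\left(\frac{1-\sum_{j=1}^n|z_0^{(j)}|^2}{1-\sum_{j=1}^n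 z_j\overline{z_0^{(j)}}}\right)^{\frac{2n}{p}},$$ where the power is the principal branch (its base has positive real part). Moreover, $\|f_{\min}\|_{H^p(B_n)}=|w_0|\,(1-\|z_0\|^2)^{n/p}$. -/

import Mathlib

open MeasureTheory Metric Set
open scoped ENNReal

noncomputable section

/-- The space `ℂⁿ` with its Euclidean (Hermitian) inner product and norm. -/
abbrev CSpace (n : ℕ) : Type := EuclideanSpace ℂ (Fin n)

/-- The normalized surface measure `σ` on the unit sphere of `ℂⁿ`: Lebesgue measure in polar
coordinates, divided by its total mass. For `n ≥ 1` it is the rotation-invariant Borel probability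
measure, see `sphereMeasure_isProbabilityMeasure` and `sphereMeasure_rotation_invariant`. -/
def sphereMeasure (n : ℕ) : Measure (sphere (0 : CSpace n) 1) :=
  ((volume : Measure (CSpace n)).toSphere univ)⁻¹ • (volume : Measure (CSpace n)).toSphere

theorem sphereMeasure_isProbabilityMeasure {n : ℕ} (hn : 1 ≤ n) :
    IsProbabilityMeasure (sphereMeasure n) := by
  have : NeZero n := ⟨by omega⟩
  have h0 : (volume : Measure (CSpace n)).toSphere univ ≠ 0 := by
    rw [Ne, Measure.measure_univ_eq_zero]
    exact Measure.toSphere_ne_zero _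
  exact ⟨by simpa [sphereMeasure] using ENNReal.inv_mul_cancel h0 (measure_ne_top _ _)⟩

open scoped Pointwise in
theorem sphereMeasure_rotation_invariant {n : ℕ} (U : CSpace n ≃ₗᵢ[ℝ] CSpace n) :
    (sphereMeasure n).map (fun ζ : sphere (0 : CSpace n) 1 =>
      (⟨U (ζ : CSpace n), by simp⟩ : sphere (0 : CSpace n) 1)) = sphereMeasure n := by
  have hc : Measurable (fun ζ : sphere (0 : CSpace n) 1 =>
      (⟨U (ζ : CSpace n), by simp⟩ : sphere (0 : CSpace n) 1)) :=
    (Continuous.subtype_mk (U.continuous.comp continuous_subtype_val) _).measurable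
  rw [sphereMeasure, Measure.map_smul]
  congr 1
  ext s hs
  rw [Measure.map_apply hc hs, Measure.toSphere_apply' _ (hc hs), Measure.toSphere_apply' _ hs]
  congr 1
  rw [← U.measurePreserving.measure_preimage_emb U.toHomeomorph.measurableEmbedding
    (Ioo (0 : ℝ) 1 • (Subtype.val '' s))]
  congr 1
  ext x
  simp only [Set.mem_smul, mem_preimage, mem_image]
  constructor
  · rintro ⟨r, hr, _, ⟨ζ, hζ, rfl⟩, rfl⟩
    exact ⟨r, hr, _, ⟨_, hζ, rfl⟩, by simp⟩
  · rintro ⟨r, hr, _, ⟨ζ, hζ, rfl⟩, h⟩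
    refine ⟨r, hr, _, ⟨⟨U.symm (ζ : CSpace n), by simp⟩, by simpa using hζ, rfl⟩, ?_⟩
    apply U.injective
    simpa using h

/-- The Hardy norm `sup_{0<r<1} (∫ |f(rζ)|^p dσ(ζ))^{1/p}`, with values in `[0, ∞]`. It depends only
on the values of `f` in the open unit ball. -/
def hardyNorm {n : ℕ} (p : ℝ) (f : CSpace n → ℂ) : ℝ≥0∞ :=
  ⨆ r ∈ Ioo (0 : ℝ) 1,
    (∫⁻ ζ : sphere (0 : CSpace n) 1, ‖f (r • (ζ : CSpace n))‖ₑ ^ p ∂(sphereMeasure n)) ^ (1 / p)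

/-- `f` belongs to the Hardy space of the unit ball: it is holomorphic in the open unit ball and has
finite Hardy norm. Functions are total; only their values in the ball matter. -/
def MemHardy {n : ℕ} (p : ℝ) (f : CSpace n → ℂ) : Prop :=
  DifferentiableOn ℂ f (ball 0 1) ∧ hardyNorm p f < ∞

/-- `f` is a minimal norm interpolant in the Hardy space for the condition `f z₀ = w₀`. -/
def IsMinNormInterpolant {n : ℕ} (p : ℝ) (z₀ : CSpace n) (w₀ : ℂ) (f : CSpace n → ℂ) : Prop :=
  MemHardy p f ∧ f z₀ = w₀ ∧
    ∀ g : CSpace n → ℂ, MemHardy p g → g z₀ = w₀ → hardyNorm p f ≤ hardyNorm p g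

/-- The function `w₀ ((1 - ‖z₀‖²) / (1 - ⟨z, z₀⟩))^{2n/p}`, with the principal branch of the power.
Mathlib's inner product is conjugate-linear in its first argument, so `⟨z, z₀⟩ = ∑ zⱼ conj(z₀ⱼ)` is
`inner ℂ z₀ z`. -/
def fMin {n : ℕ} (p : ℝ) (z₀ : CSpace n) (w₀ : ℂ) (z : CSpace n) : ℂ :=
  w₀ * ((1 - (‖z₀‖ : ℂ) ^ 2) / (1 - inner ℂ z₀ z)) ^ ((2 * n / p : ℝ) : ℂ)

end

open Filter
open scoped Topology

/-! On the sphere `‖fMin‖ ^ p` is the constant `M = ‖w₀‖ ^ p * (1 - ‖z₀‖ ^ 2) ^ n` times the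
Poisson-Szegő kernel at `z₀`, a probability density that reproduces holomorphic functions
(`integral_mul_poissonSzego`, a consequence of `szego_formula`). For a competitor `f`, the quotient
`u = f(r ·) / fMin` is holomorphic past the closed ball, because `fMin` has no zeros, and the
`p`-mean of `f` on radius `r` is `M` times the Poisson-Szegő average of `‖u‖ ^ p`.

Write `‖w‖ ^ p` as its tangent at `1` plus a nonnegative gap. The reproducing property turns the
mean into `M (1 + p Re (u z₀ - 1) + average gap)` (`integral_norm_dilate_rpow`). As `r → 1`, `u z₀ →
1`, so the norm to the power `p` is at least `M`; `hardyNorm_fMin_le` shows that `fMin` attains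
this.

If `f` attains it too, the average gap tends to `0`. The gap controls `‖u - 1‖`
(`exists_norm_sub_one_le_rpowGap`), and a Harnack comparison of kernels carries the smallness from
`z₀` to any `z`, so `f z = fMin z`. Working with dilates avoids boundary values of Hardy functions
altogether. -/

/-! ### Integrability and isometry invariance on the sphere. -/

theorem continuous_integrable_sphereMeasure {n : ℕ} (hn : 1 ≤ n) {E : Type*}
    [NormedAddCommGroup E] {F : sphere (0 : CSpace n) 1 → E}
    (hF : Continuous F) : Integrable F (sphereMeasure n) := by
  have := sphereMeasure_isProbabilityMeasure hn
  exact hF.integrable_of_hasCompactSupport (HasCompactSupport.of_compactSpace F)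

theorem integral_sphereMeasure_comp_isometry {n : ℕ} {E : Type*} [NormedAddCommGroup E]
    [NormedSpace ℝ E] (U : CSpace n ≃ₗᵢ[ℝ] CSpace n) (F : CSpace n → E) :
    ∫ ζ : sphere (0 : CSpace n) 1, F (U ζ) ∂(sphereMeasure n) =
      ∫ ζ : sphere (0 : CSpace n) 1, F ζ ∂(sphereMeasure n) := by
  have hc : Continuous (fun ζ : sphere (0 : CSpace n) 1 =>
      (⟨U (ζ : CSpace n), by simp⟩ : sphere (0 : CSpace n) 1)) :=
    Continuous.subtype_mk (U.continuous.comp continuous_subtype_val) _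
  have hi : Function.Injective (fun ζ : sphere (0 : CSpace n) 1 =>
      (⟨U (ζ : CSpace n), by simp⟩ : sphere (0 : CSpace n) 1)) := by
    intro a b hab
    exact Subtype.ext (U.injective (congrArg Subtype.val hab))
  have hm : MeasurePreserving (fun ζ : sphere (0 : CSpace n) 1 =>
      (⟨U (ζ : CSpace n), by simp⟩ : sphere (0 : CSpace n) 1)) (sphereMeasure n)
      (sphereMeasure n) := ⟨hc.measurable, sphereMeasure_rotation_invariant U⟩
  exact hm.integral_comp (hc.isClosedEmbedding hi).measurableEmbedding (fun ζ => F ζ)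

/-! ### Polar coordinates and the moments of one coordinate. -/

/-- Integration in polar coordinates of a product of a function on the sphere and a radial one. -/
theorem integral_polar_mul {E : Type*} [NormedAddCommGroup E] [NormedSpace ℝ E]
    [MeasurableSpace E] [BorelSpace E] [FiniteDimensional ℝ E] [Nontrivial E] (μ : Measure E)
    [μ.IsAddHaarMeasure] (g : sphere (0 : E) 1 → ℝ) (φ : ℝ → ℝ) (F : E → ℝ)
    (hF : ∀ (ζ : sphere (0 : E) 1) (r : ℝ), 0 < r → F (r • (ζ : E)) = g ζ * φ r) :
    ∫ x, F x ∂μ = (∫ ζ, g ζ ∂μ.toSphere) *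
      ∫ r in Ioi (0 : ℝ), r ^ (Module.finrank ℝ E - 1) * φ r :=
  calc
    ∫ x, F x ∂μ = ∫ x : ({(0)}ᶜ : Set E), F x.1 ∂(μ.comap (↑)) := by
      rw [integral_subtype_comap (measurableSet_singleton _).compl fun x ↦ F x,
        restrict_compl_singleton]
    _ = ∫ x, g x.1 * φ x.2 ∂μ.toSphere.prod (.volumeIoiPow (Module.finrank ℝ E - 1)) := by
      rw [← μ.measurePreserving_homeomorphUnitSphereProd.integral_comp
        (Homeomorph.measurableEmbedding _) (fun x => g x.1 * φ x.2)]
      refine integral_congr_ae (Filter.Eventually.of_forall fun x => ?_)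
      have h0 : 0 < ‖(x : E)‖ := norm_pos_iff.2 x.2
      have := hF (homeomorphUnitSphereProd E x).1 ‖(x : E)‖ h0
      rw [homeomorphUnitSphereProd_apply_fst_coe, smul_smul, mul_inv_cancel₀ h0.ne',
        one_smul] at this
      simpa using this
    _ = (∫ ζ, g ζ ∂μ.toSphere) *
        ∫ x : Ioi (0 : ℝ), φ x ∂.volumeIoiPow (Module.finrank ℝ E - 1) :=
      integral_prod_mul g (fun x : Ioi (0 : ℝ) => φ x)
    _ = _ := by
      congr 1
      simp only [Measure.volumeIoiPow, ENNReal.ofReal]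
      rw [integral_withDensity_eq_integral_smul,
        integral_subtype_comap measurableSet_Ioi
          fun a ↦ Real.toNNReal (a ^ (Module.finrank ℝ E - 1)) • φ a,
        setIntegral_congr_fun measurableSet_Ioi fun x hx ↦ ?_]
      · rw [NNReal.smul_def, Real.coe_toNNReal _ (pow_nonneg hx.out.le _), smul_eq_mul]
      · exact (measurable_subtype_coe.pow_const _).real_toNNReal

theorem finrank_real_CSpace (n : ℕ) : Module.finrank ℝ (CSpace n) = 2 * n := by
  have := Module.finrank_mul_finrank ℝ ℂ (CSpace n)
  simpa using this.symm

/-- Uniqueness of Haar measure. The value of `c` is irrelevant, since it cancels when the sphere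
measure is normalized. -/
theorem exists_integral_CSpace_eq_smul (n : ℕ) : ∃ c : ℝ, ∀ F : CSpace n → ℝ,
    ∫ x, F x = c * ∫ y : Fin n → ℂ, F (WithLp.toLp 2 y) := by
  let e : (Fin n → ℂ) ≃L[ℝ] CSpace n := (PiLp.continuousLinearEquiv 2 ℝ (fun _ : Fin n => ℂ)).symm
  have he : (Measure.map e (volume : Measure (Fin n → ℂ))).IsAddHaarMeasure :=
    e.isAddHaarMeasure_map _
  have h := Measure.isAddLeftInvariant_eq_smul (volume : Measure (CSpace n))
    (Measure.map e (volume : Measure (Fin n → ℂ)))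
  refine ⟨(volume : Measure (CSpace n)).addHaarScalarFactor
    (Measure.map e (volume : Measure (Fin n → ℂ))), fun F => ?_⟩
  conv_lhs => rw [h]
  have he : MeasurableEmbedding e := e.toHomeomorph.measurableEmbedding
  rw [integral_smul_nnreal_measure, he.integral_map]
  rfl

theorem integral_norm_pow_mul_exp_neg_sq_complex (k : ℕ) :
    ∫ z : ℂ, ‖z‖ ^ (2 * k) * Real.exp (-‖z‖ ^ 2) = Real.pi * k.factorial := by
  have := Complex.integral_rpow_mul_exp_neg_rpow (p := 2) (q := 2 * k) (by norm_num)
    (by have : (0 : ℝ) ≤ k := k.cast_nonneg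
        linarith)
  rw [show ((2 * k + 2) / 2 : ℝ) = k + 1 by ring, Real.Gamma_nat_eq_factorial] at this
  rw [show Real.pi * (k.factorial : ℝ) = 2 * Real.pi / 2 * k.factorial by ring, ← this]
  refine integral_congr_ae (Filter.Eventually.of_forall fun z => ?_)
  simp only
  rw [← Real.rpow_natCast, ← Real.rpow_natCast ‖z‖ 2]
  push_cast
  rfl

theorem integral_pow_mul_exp_neg_sq {m : ℕ} (hm : 1 ≤ m) :
    ∫ r in Ioi (0 : ℝ), r ^ (2 * m - 1) * Real.exp (-r ^ 2) = (m - 1).factorial / 2 := by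
  obtain ⟨m, rfl⟩ := Nat.exists_eq_add_of_le' hm
  have := integral_rpow_mul_exp_neg_rpow (p := 2) (q := (2 * m + 1 : ℕ)) (by norm_num)
    (by have : (0 : ℝ) ≤ (2 * m + 1 : ℕ) := Nat.cast_nonneg _
        linarith)
  rw [show (((2 * m + 1 : ℕ) + 1) / 2 : ℝ) = m + 1 by push_cast; ring,
    Real.Gamma_nat_eq_factorial] at this
  rw [show 2 * (m + 1) - 1 = 2 * m + 1 by omega, Nat.add_sub_cancel,
    show ((m.factorial : ℝ) / 2) = 1 / 2 * m.factorial by ring, ← this]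
  refine setIntegral_congr_fun measurableSet_Ioi fun r hr => ?_
  rw [Real.rpow_natCast, ← Real.rpow_natCast r 2]
  rfl

theorem integral_gaussian_moment_pi {n : ℕ} (i : Fin n) (k : ℕ) :
    ∫ y : Fin n → ℂ, ‖y i‖ ^ (2 * k) * Real.exp (-∑ j, ‖y j‖ ^ 2) =
      Real.pi ^ n * k.factorial := by
  have h := integral_fintype_prod_volume_eq_prod (𝕜 := ℝ) (ι := Fin n) (E := fun _ => ℂ)
    (fun j z => ‖z‖ ^ (2 * (if j = i then k else 0)) * Real.exp (-‖z‖ ^ 2))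
  simp only [integral_norm_pow_mul_exp_neg_sq_complex, Finset.prod_mul_distrib] at h
  rw [Finset.prod_const, Finset.card_univ, Fintype.card_fin] at h
  have h1 : ∀ y : Fin n → ℂ, ∏ j, ‖y j‖ ^ (2 * if j = i then k else 0) = ‖y i‖ ^ (2 * k) :=
    fun y => by rw [Finset.prod_eq_single i] <;> simp +contextual
  have h2 : ∏ j : Fin n, ((if j = i then k else 0).factorial : ℝ) = k.factorial := by
    rw [Finset.prod_eq_single i] <;> simp +contextual
  simpa only [h1, h2, ← Real.exp_sum, Finset.sum_neg_distrib] using h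

/-- The Gaussian integral of `‖x i‖ ^ (2 * k)` is computed twice: in polar coordinates, and by
Fubini over the coordinates. What matters is that `C` does not depend on `k`. -/
theorem integral_toSphere_moment {n : ℕ} (hn : 1 ≤ n) (i : Fin n) : ∃ C : ℝ, ∀ k : ℕ,
    (∫ ζ : sphere (0 : CSpace n) 1, ‖(ζ : CSpace n) i‖ ^ (2 * k)
      ∂(volume : Measure (CSpace n)).toSphere) * (n + k - 1).factorial = C * k.factorial := by
  have : NeZero n := ⟨by omega⟩
  obtain ⟨c, hc⟩ := exists_integral_CSpace_eq_smul n
  refine ⟨2 * c * Real.pi ^ n, fun k => ?_⟩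
  have h1 := integral_polar_mul (volume : Measure (CSpace n))
    (fun ζ => ‖(ζ : CSpace n) i‖ ^ (2 * k)) (fun r => r ^ (2 * k) * Real.exp (-r ^ 2))
    (fun x => ‖x i‖ ^ (2 * k) * Real.exp (-‖x‖ ^ 2)) (fun ζ r hr => by
      simp [norm_smul, abs_of_pos hr, mul_pow]
      ring)
  rw [hc, finrank_real_CSpace] at h1
  simp only [EuclideanSpace.norm_sq_eq] at h1
  rw [integral_gaussian_moment_pi i k] at h1
  have h2 : ∫ r in Ioi (0 : ℝ), r ^ (2 * n - 1) * (r ^ (2 * k) * Real.exp (-r ^ 2)) =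
      (n + k - 1).factorial / 2 := by
    rw [← integral_pow_mul_exp_neg_sq (by omega : 1 ≤ n + k)]
    refine setIntegral_congr_fun measurableSet_Ioi fun r _ => ?_
    rw [← mul_assoc, ← pow_add]
    congr 2
    omega
  rw [h2] at h1
  linarith

/-- The case `k = 0`, where the integral is the total mass `1`, determines the unknown constant. -/
theorem integral_sphereMeasure_norm_pow {n : ℕ} (hn : 1 ≤ n) (i : Fin n) (k : ℕ) :
    ((n - 1 + k).choose (n - 1) : ℝ) * ∫ ζ : sphere (0 : CSpace n) 1,
      ‖(ζ : CSpace n) i‖ ^ (2 * k) ∂(sphereMeasure n) = 1 := by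
  have := sphereMeasure_isProbabilityMeasure hn
  obtain ⟨C, hC⟩ := integral_toSphere_moment hn i
  set a : ℝ := (((volume : Measure (CSpace n)).toSphere univ)⁻¹).toReal
  have hs : ∀ k : ℕ, (∫ ζ : sphere (0 : CSpace n) 1, ‖(ζ : CSpace n) i‖ ^ (2 * k)
      ∂(sphereMeasure n)) * (n + k - 1).factorial = a * C * k.factorial := by
    intro k
    rw [sphereMeasure, integral_smul_measure, smul_eq_mul, mul_assoc, hC k, mul_assoc]
  have h0 := hs 0
  have hk := hs k
  simp only [mul_zero, pow_zero, integral_const, probReal_univ, smul_eq_mul, mul_one,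
    add_zero, one_mul, Nat.factorial_zero, Nat.cast_one] at h0
  rw [← h0, show n + k - 1 = n - 1 + k by omega] at hk
  have hch : (((n - 1 + k).choose (n - 1) * (n - 1).factorial * k.factorial : ℕ) : ℝ) =
      (n - 1 + k).factorial := by
    congr 1
    have := Nat.choose_mul_factorial_mul_factorial (Nat.le_add_right (n - 1) k)
    simpa using this
  push_cast at hch
  rw [← hch] at hk
  have hp1 : ((n - 1).factorial : ℝ) ≠ 0 := by positivity
  have hp2 : (k.factorial : ℝ) ≠ 0 := by positivity
  apply mul_right_cancel₀ (mul_ne_zero hp1 hp2)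
  linarith

/-- Orthogonality of distinct powers of a coordinate, from invariance under a common phase. -/
theorem integral_sphereMeasure_pow_mul_conj_pow_of_ne {n : ℕ} (i : Fin n) {m k : ℕ}
    (hmk : m ≠ k) : ∫ ζ : sphere (0 : CSpace n) 1,
      ((ζ : CSpace n) i) ^ m * (starRingEnd ℂ ((ζ : CSpace n) i)) ^ k ∂(sphereMeasure n) = 0 := by
  -- This phase makes `c ^ (m - k) = -1`, so invariance makes the integral equal to its own
  -- negative.
  set θ : ℝ := Real.pi / ((m : ℝ) - k)
  have hd : (m : ℝ) - k ≠ 0 := sub_ne_zero.2 (by exact_mod_cast hmk)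
  set c : ℂ := Complex.exp (θ * Complex.I)
  have hc : ‖c‖ = 1 := Complex.norm_exp_ofReal_mul_I θ
  have hcc : c ^ m * (starRingEnd ℂ c) ^ k = -1 := by
    rw [← Complex.exp_conj, ← Complex.exp_nat_mul, ← Complex.exp_nat_mul, ← Complex.exp_add,
      ← Complex.exp_pi_mul_I]
    congr 1
    have : (Real.pi : ℂ) = θ * (m - k) := by
      rw [← Complex.ofReal_natCast, ← Complex.ofReal_natCast k, ← Complex.ofReal_sub,
        ← Complex.ofReal_mul]
      congr 1
      simp only [θ]
      field_simp
    rw [this]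
    simp
    ring
  let U : CSpace n ≃ₗᵢ[ℝ] CSpace n :=
    { toLinearEquiv := (LinearEquiv.smulOfNeZero ℂ (CSpace n) c
        (by simp [c])).restrictScalars ℝ
      norm_map' := fun x => by
        change ‖c • x‖ = ‖x‖
        rw [norm_smul, hc, one_mul] }
  have h := integral_sphereMeasure_comp_isometry U
    (fun x : CSpace n => (x i) ^ m * (starRingEnd ℂ (x i)) ^ k)
  have hU : ∀ x i, (U x) i = c * x i := fun x i => rfl
  simp only [hU, map_mul, mul_pow] at h
  have h2 : ∀ a b : ℂ, c ^ m * a * ((starRingEnd ℂ c) ^ k * b) = -(a * b) := by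
    intro a b
    linear_combination (a * b) * hcc
  simp only [h2, integral_neg] at h
  exact self_eq_neg.1 h.symm

theorem integral_sphereMeasure_pow_mul_conj_pow {n : ℕ} (hn : 1 ≤ n) (i : Fin n) (k : ℕ) :
    ((n - 1 + k).choose (n - 1) : ℂ) * ∫ ζ : sphere (0 : CSpace n) 1,
      ((ζ : CSpace n) i) ^ k * (starRingEnd ℂ ((ζ : CSpace n) i)) ^ k ∂(sphereMeasure n) = 1 := by
  have h := integral_sphereMeasure_norm_pow hn i k
  have h2 : ∀ z : ℂ, z ^ k * (starRingEnd ℂ z) ^ k = ((‖z‖ ^ (2 * k) : ℝ) : ℂ) := by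
    intro z
    rw [← mul_pow, Complex.mul_conj, Complex.normSq_eq_norm_sq, pow_mul]
    push_cast
    rfl
  simp only [h2]
  rw [integral_complex_ofReal]
  exact_mod_cast h

/-! ### Averaging over rotations that fix one coordinate. -/

/-- Multiplication of all coordinates but the `i`-th one by a unimodular number. -/
noncomputable def rotateOthers {n : ℕ} (i : Fin n) (c : Circle) : CSpace n ≃ₗᵢ[ℝ] CSpace n :=
  LinearIsometryEquiv.piLpCongrRight 2
    (fun j => if j = i then LinearIsometryEquiv.refl ℝ ℂ else rotation c)

theorem rotateOthers_apply {n : ℕ} (i : Fin n) (c : Circle) (x : CSpace n) :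
    rotateOthers i c x =
      EuclideanSpace.single i (x i) + (c : ℂ) • (x - EuclideanSpace.single i (x i)) := by
  ext j
  by_cases h : j = i
  · subst h
    simp [rotateOthers]
  · simp [rotateOthers, h]

theorem norm_single_add_smul_le {n : ℕ} (i : Fin n) (x : CSpace n) {w : ℂ} (hw : ‖w‖ ≤ 1) :
    ‖EuclideanSpace.single i (x i) + w • (x - EuclideanSpace.single i (x i))‖ ≤ ‖x‖ := by
  rw [EuclideanSpace.norm_eq, EuclideanSpace.norm_eq]
  refine Real.sqrt_le_sqrt (Finset.sum_le_sum fun j _ => ?_)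
  by_cases h : j = i
  · subst h
    simp
  · simp [h]
    gcongr
    exact mul_le_of_le_one_left (norm_nonneg _) hw

theorem differentiable_single {n : ℕ} (i : Fin n) :
    Differentiable ℂ fun w : ℂ => (EuclideanSpace.single i w : CSpace n) := by
  have : (fun w : ℂ => (EuclideanSpace.single i w : CSpace n)) =
      fun w => w • EuclideanSpace.single i 1 := by
    ext w j
    by_cases h : j = i <;> simp [h]
  rw [this]
  fun_prop

/-- Rotating the other coordinates leaves `h` unchanged, and the mean of `g` over these rotations
is, by the mean value property in the common factor `w`, its value at `w = 0`. Only continuity is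
asked of `h`, because the Szegő kernel is antiholomorphic in `ζ`. -/
theorem integral_sphereMeasure_slice {n : ℕ} (hn : 1 ≤ n) (i : Fin n) {R : ℝ} (hR : 1 < R)
    {g : CSpace n → ℂ} (hg : DifferentiableOn ℂ g (ball 0 R)) {h : ℂ → ℂ}
    (hh : ContinuousOn h (closedBall 0 1)) :
    ∫ ζ : sphere (0 : CSpace n) 1, g ζ * h ((ζ : CSpace n) i) ∂(sphereMeasure n) =
      ∫ ζ : sphere (0 : CSpace n) 1,
        g (EuclideanSpace.single i ((ζ : CSpace n) i)) * h ((ζ : CSpace n) i)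
          ∂(sphereMeasure n) := by
  have := sphereMeasure_isProbabilityMeasure hn
  have hgc : ContinuousOn g (closedBall 0 1) :=
    hg.continuousOn.mono (closedBall_subset_ball hR)
  let ℓ : ℂ → CSpace n → CSpace n := fun w x =>
    EuclideanSpace.single i (x i) + w • (x - EuclideanSpace.single i (x i))
  have hℓ : ∀ (w : ℂ) (ζ : sphere (0 : CSpace n) 1), ‖w‖ ≤ 1 →
      ℓ w ζ ∈ closedBall (0 : CSpace n) 1 := fun w ζ hw => by
    simpa using norm_single_add_smul_le i (ζ : CSpace n) hw
  have hi : ∀ ζ : sphere (0 : CSpace n) 1, (ζ : CSpace n) i ∈ closedBall (0 : ℂ) 1 := fun ζ => by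
    simpa using PiLp.norm_apply_le (ζ : CSpace n) i
  have hrot : ∀ θ : ℝ, ∫ ζ : sphere (0 : CSpace n) 1,
      g (ℓ (circleMap 0 1 θ) ζ) * h ((ζ : CSpace n) i) ∂(sphereMeasure n) =
      ∫ ζ : sphere (0 : CSpace n) 1, g ζ * h ((ζ : CSpace n) i) ∂(sphereMeasure n) := by
    intro θ
    rw [← integral_sphereMeasure_comp_isometry (rotateOthers i (Circle.exp θ))
      (fun x => g x * h (x i))]
    simp [rotateOthers_apply, ℓ, circleMap, Circle.coe_exp]
  have hmean : ∀ ζ : sphere (0 : CSpace n) 1,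
      ∫ θ in (0)..(2 * Real.pi), g (ℓ (circleMap 0 1 θ) ζ) * h ((ζ : CSpace n) i) =
      (2 * Real.pi) * (g (EuclideanSpace.single i ((ζ : CSpace n) i)) * h ((ζ : CSpace n) i)) := by
    intro ζ
    have hd : DifferentiableOn ℂ (fun w => g (ℓ w ζ)) (closure (ball (0 : ℂ) |1|)) := by
      rw [abs_one, closure_ball _ one_ne_zero]
      refine hg.comp (Differentiable.differentiableOn (by fun_prop)) fun w hw => ?_
      exact closedBall_subset_ball hR (hℓ w ζ (by simpa using hw))
    have h1 := hd.diffContOnCl.circleAverage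
    rw [Real.circleAverage_def, inv_smul_eq_iff₀ (by positivity)] at h1
    rw [intervalIntegral.integral_mul_const, h1]
    simp [ℓ, mul_assoc]
  obtain ⟨C₁, hC₁⟩ := (isCompact_closedBall (0 : CSpace n) 1).exists_bound_of_continuousOn hgc
  obtain ⟨C₂, hC₂⟩ := (isCompact_closedBall (0 : ℂ) 1).exists_bound_of_continuousOn hh
  have : IsFiniteMeasure (volume.restrict (uIoc 0 (2 * Real.pi))) :=
    inferInstanceAs (IsFiniteMeasure (volume.restrict (Ioc _ _)))
  have hswap := intervalIntegral_integral_swap (μ := sphereMeasure n) (a := 0) (b := 2 * Real.pi)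
    (f := fun θ (ζ : sphere (0 : CSpace n) 1) =>
      g (ℓ (circleMap 0 1 θ) ζ) * h ((ζ : CSpace n) i)) (by
    refine Integrable.of_bound (C := C₁ * C₂) (Continuous.aestronglyMeasurable ?_) ?_
    · refine Continuous.mul ?_ ?_
      · refine hgc.comp_continuous (f := fun q : ℝ × sphere (0 : CSpace n) 1 =>
          ℓ (circleMap 0 1 q.1) q.2) (by
            have hs : Continuous fun q : ℝ × sphere (0 : CSpace n) 1 =>
                EuclideanSpace.single (𝕜 := ℂ) i ((q.2 : CSpace n) i) :=
              (differentiable_single i).continuous.comp (by fun_prop)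
            have hc : Continuous fun q : ℝ × sphere (0 : CSpace n) 1 => circleMap 0 1 q.1 :=
              (continuous_circleMap 0 1).comp continuous_fst
            have hz : Continuous fun q : ℝ × sphere (0 : CSpace n) 1 => (q.2 : CSpace n) :=
              continuous_subtype_val.comp continuous_snd
            exact hs.add (hc.smul (hz.sub hs))) fun q => hℓ _ _ (by simp)
      · exact hh.comp_continuous (f := fun q : ℝ × sphere (0 : CSpace n) 1 =>
          (q.2 : CSpace n) i) (by fun_prop) fun q => hi _
    · refine Filter.Eventually.of_forall fun q => ?_
      simp only [Function.uncurry, norm_mul]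
      have a1 := hC₁ _ (hℓ (circleMap 0 1 q.1) q.2 (by simp))
      have a2 := hC₂ _ (hi q.2)
      exact mul_le_mul a1 a2 (norm_nonneg _) ((norm_nonneg _).trans a1))
  simp only [hrot, hmean] at hswap
  rw [intervalIntegral.integral_const, sub_zero, integral_const_mul] at hswap
  have hpi : ((2 * Real.pi : ℝ) : ℂ) ≠ 0 := by exact_mod_cast (by positivity : 2 * Real.pi ≠ 0)
  apply mul_left_cancel₀ hpi
  rw [← Complex.real_smul, hswap]
  push_cast
  rfl

/-! ### Power series on the sphere and the Szegő formula. -/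

theorem hasSum_integral_of_bounded_coeff {X : Type*} [MeasurableSpace X] [TopologicalSpace X]
    [CompactSpace X] [OpensMeasurableSpace X] (μ : Measure X) [IsProbabilityMeasure μ]
    {a : ℕ → ℂ} (ha : Summable fun k => ‖a k‖) {e : ℕ → X → ℂ} (he : ∀ k, Continuous (e k))
    {C : ℝ} (heC : ∀ k x, ‖e k x‖ ≤ C) :
    HasSum (fun k => a k * ∫ x, e k x ∂μ) (∫ x, ∑' k, a k * e k x ∂μ) := by
  have hint : ∀ k, Integrable (fun x => a k * e k x) μ := fun k =>
    (Continuous.integrable_of_hasCompactSupport (by fun_prop) (HasCompactSupport.of_compactSpace _))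
  have := hasSum_integral_of_summable_integral_norm hint (by
    refine Summable.of_nonneg_of_le (fun k => integral_nonneg fun x => norm_nonneg _)
      (fun k => ?_) (ha.mul_right C)
    calc ∫ x, ‖a k * e k x‖ ∂μ ≤ ∫ _, ‖a k‖ * C ∂μ := by
          refine integral_mono (hint k).norm (integrable_const _) fun x => ?_
          simp only [norm_mul]
          exact mul_le_mul_of_nonneg_left (heC k x) (norm_nonneg _)
      _ = ‖a k‖ * C := by simp)
  simpa only [integral_const_mul] using this

/-- A Parseval identity: both series are integrated termwise, one after the other, and orthogonality
leaves only the diagonal. -/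
theorem integral_sphereMeasure_series {n : ℕ} (hn : 1 ≤ n) (i : Fin n) {a b : ℕ → ℂ}
    (ha : Summable fun k => ‖a k‖) (hb : Summable fun k => ‖b k‖) :
    HasSum (fun k => b k * (a k * ∫ ζ : sphere (0 : CSpace n) 1,
        ((ζ : CSpace n) i) ^ k * (starRingEnd ℂ ((ζ : CSpace n) i)) ^ k ∂(sphereMeasure n)))
      (∫ ζ : sphere (0 : CSpace n) 1, (∑' m, a m * ((ζ : CSpace n) i) ^ m) *
        (∑' k, b k * (starRingEnd ℂ ((ζ : CSpace n) i)) ^ k) ∂(sphereMeasure n)) := by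
  have := sphereMeasure_isProbabilityMeasure hn
  have hi : ∀ ζ : sphere (0 : CSpace n) 1, ‖(ζ : CSpace n) i‖ ≤ 1 := fun ζ => by
    simpa using PiLp.norm_apply_le (ζ : CSpace n) i
  have hin : ∀ k, ∫ ζ : sphere (0 : CSpace n) 1, (∑' m, a m * ((ζ : CSpace n) i) ^ m) *
      (starRingEnd ℂ ((ζ : CSpace n) i)) ^ k ∂(sphereMeasure n) =
      a k * ∫ ζ : sphere (0 : CSpace n) 1,
        ((ζ : CSpace n) i) ^ k * (starRingEnd ℂ ((ζ : CSpace n) i)) ^ k ∂(sphereMeasure n) := by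
    intro k
    have h1 := hasSum_integral_of_bounded_coeff (sphereMeasure n) ha
      (e := fun m (ζ : sphere (0 : CSpace n) 1) =>
        ((ζ : CSpace n) i) ^ m * (starRingEnd ℂ ((ζ : CSpace n) i)) ^ k)
      (fun m => by fun_prop) (fun m ζ => by
        rw [norm_mul, norm_pow, norm_pow, RCLike.norm_conj]
        exact mul_le_one₀ (pow_le_one₀ (norm_nonneg _) (hi ζ)) (by positivity)
          (pow_le_one₀ (norm_nonneg _) (hi ζ)))
    have h2 := h1.unique (hasSum_single k fun m hm => by
      rw [integral_sphereMeasure_pow_mul_conj_pow_of_ne i hm, mul_zero])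
    rw [← h2]
    simp only [← mul_assoc, tsum_mul_right]
  have hcont : Continuous fun ζ : sphere (0 : CSpace n) 1 => ∑' m, a m * ((ζ : CSpace n) i) ^ m :=
    continuous_tsum (fun m => by fun_prop) ha fun m ζ => by
      rw [norm_mul, norm_pow]
      exact mul_le_of_le_one_right (norm_nonneg _) (pow_le_one₀ (norm_nonneg _) (hi ζ))
  obtain ⟨C, hC⟩ := isCompact_univ.exists_bound_of_continuousOn hcont.continuousOn
  have h3 := hasSum_integral_of_bounded_coeff (sphereMeasure n) hb
    (e := fun k (ζ : sphere (0 : CSpace n) 1) => (∑' m, a m * ((ζ : CSpace n) i) ^ m) *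
      (starRingEnd ℂ ((ζ : CSpace n) i)) ^ k) (fun k => hcont.mul (by fun_prop))
    (C := C) (fun k ζ => by
      rw [norm_mul, norm_pow, RCLike.norm_conj]
      exact (mul_le_of_le_one_right (norm_nonneg _)
        (pow_le_one₀ (norm_nonneg _) (hi ζ))).trans (hC ζ (mem_univ ζ)))
  simp only [hin] at h3
  convert! h3 using 3 with ζ
  rw [← tsum_mul_left]
  exact tsum_congr fun k => by ring

/-- After slicing, `g` becomes a power series in one coordinate. The binomial coefficients in the
expansion of the kernel are the reciprocals of the moments, so the pairing returns the Taylor series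
of the slice at `t`. -/
theorem szego_formula_coordinate {n : ℕ} (hn : 1 ≤ n) (i : Fin n) {R : ℝ} (hR : 1 < R)
    {g : CSpace n → ℂ} (hg : DifferentiableOn ℂ g (ball 0 R)) {t : ℂ} (ht : ‖t‖ < 1) :
    ∫ ζ : sphere (0 : CSpace n) 1,
      g ζ * (1 / (1 - t * starRingEnd ℂ ((ζ : CSpace n) i)) ^ n) ∂(sphereMeasure n) =
      g (EuclideanSpace.single i t) := by
  have hi : ∀ ζ : sphere (0 : CSpace n) 1, ‖(ζ : CSpace n) i‖ ≤ 1 := fun ζ => by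
    simpa using PiLp.norm_apply_le (ζ : CSpace n) i
  have hG : DifferentiableOn ℂ (fun w => g (EuclideanSpace.single i w)) (ball 0 R) :=
    hg.comp (differentiable_single i).differentiableOn fun w hw => by simpa using hw
  have hlt : ∀ w : ℂ, ‖w‖ ≤ 1 → ‖t * starRingEnd ℂ w‖ < 1 := fun w hw => by
    rw [norm_mul, RCLike.norm_conj]
    exact (mul_le_of_le_one_right (norm_nonneg _) hw).trans_lt ht
  rw [integral_sphereMeasure_slice hn i hR hg
    (h := fun w => 1 / (1 - t * starRingEnd ℂ w) ^ n) (by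
      refine ContinuousOn.div (by fun_prop) (by fun_prop) fun w hw => pow_ne_zero _ fun h0 => ?_
      have := hlt w (by simpa using hw)
      rw [← sub_eq_zero.1 h0] at this
      simp at this)]
  set a : ℕ → ℂ := fun k => ((k.factorial : ℂ)⁻¹ *
    iteratedDeriv k (fun w => g (EuclideanSpace.single i w)) 0) with ha_def
  have hser : ∀ w ∈ ball (0 : ℂ) R,
      HasSum (fun k => a k * w ^ k) (g (EuclideanSpace.single i w)) := by
    intro w hw
    have := Complex.hasSum_taylorSeries_on_ball hG hw
    simp only [sub_zero, smul_eq_mul] at this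
    convert! this using 2 with k
    simp only [ha_def]
    ring
  -- Absolute summability comes from evaluating the Taylor series at `1`, which lies inside the disc
  -- of radius `R`.
  have ha : Summable fun k => ‖a k‖ := by
    simpa using (hser 1 (by simpa using hR)).summable.norm
  set b : ℕ → ℂ := fun k => ((k + (n - 1)).choose (n - 1) : ℂ) * t ^ k with hb_def
  have hn1 : n - 1 + 1 = n := by omega
  have hb : Summable fun k => ‖b k‖ :=
    (hasSum_choose_mul_geometric_of_norm_lt_one (n - 1) ht).summable.norm
  have hmain := integral_sphereMeasure_series hn i ha hb
  have hk : ∀ k, b k * (a k * ∫ ζ : sphere (0 : CSpace n) 1,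
        ((ζ : CSpace n) i) ^ k * (starRingEnd ℂ ((ζ : CSpace n) i)) ^ k ∂(sphereMeasure n)) =
        a k * t ^ k := by
    intro k
    have := integral_sphereMeasure_pow_mul_conj_pow hn i k
    rw [add_comm] at this
    simp only [hb_def]
    linear_combination (a k * t ^ k) * this
  simp only [hk] at hmain
  have ht' := hser t (by simpa using ht.trans hR)
  rw [← hmain.unique ht']
  refine integral_congr_ae (Filter.Eventually.of_forall fun ζ => ?_)
  simp only
  rw [(hser _ (by simpa using (hi ζ).trans_lt hR)).tsum_eq]
  congr 1
  have := hasSum_choose_mul_geometric_of_norm_lt_one (n - 1) (hlt _ (hi ζ))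
  rw [hn1] at this
  rw [← this.tsum_eq]
  simp only [hb_def, mul_pow, mul_assoc]

theorem exists_isometry_single_eq {n : ℕ} (i : Fin n) (z : CSpace n) :
    ∃ U : CSpace n ≃ₗᵢ[ℂ] CSpace n, U (EuclideanSpace.single i (‖z‖ : ℂ)) = z := by
  rcases eq_or_ne z 0 with rfl | hz
  · exact ⟨LinearIsometryEquiv.refl ℂ _, by simp⟩
  have hv : Orthonormal ℂ (({i} : Set (Fin n)).domRestrict
      (fun _ : Fin n => ((‖z‖ : ℂ)⁻¹) • z)) := by
    refine ⟨fun _ => ?_, fun a b hab => (hab (Subsingleton.elim a b)).elim⟩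
    have : ‖z‖ ≠ 0 := by simpa using hz
    simp [domRestrict, norm_smul, this]
  obtain ⟨b, hb⟩ := hv.exists_orthonormalBasis_extension_of_card_eq (by simp)
  refine ⟨b.repr.symm, ?_⟩
  have h1 : EuclideanSpace.single i (‖z‖ : ℂ) = (‖z‖ : ℂ) • EuclideanSpace.single i (1 : ℂ) := by
    ext j
    by_cases h : j = i <;> simp [h]
  rw [h1, map_smul, OrthonormalBasis.repr_symm_single, hb i rfl, smul_smul,
    mul_inv_cancel₀ (by simpa using hz), one_smul]

/-- A unitary map carries `z` to a coordinate axis and preserves holomorphy, the kernel and the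
measure. -/
theorem szego_formula {n : ℕ} (hn : 1 ≤ n) {R : ℝ} (hR : 1 < R)
    {g : CSpace n → ℂ} (hg : DifferentiableOn ℂ g (ball 0 R)) {z : CSpace n} (hz : ‖z‖ < 1) :
    ∫ ζ : sphere (0 : CSpace n) 1, g ζ * (1 / (1 - inner ℂ (ζ : CSpace n) z) ^ n)
      ∂(sphereMeasure n) = g z := by
  obtain ⟨U, hU⟩ := exists_isometry_single_eq (⟨0, hn⟩ : Fin n) z
  have hgU : DifferentiableOn ℂ (fun x => g (U x)) (ball 0 R) :=
    hg.comp U.toContinuousLinearEquiv.differentiable.differentiableOn fun x hx => by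
      simpa using hx
  have h := szego_formula_coordinate hn ⟨0, hn⟩ hR hgU (t := (‖z‖ : ℂ)) (by simpa using hz)
  rw [hU] at h
  rw [← h]
  let V : CSpace n ≃ₗᵢ[ℝ] CSpace n :=
    { toLinearEquiv := U.toLinearEquiv.restrictScalars ℝ
      norm_map' := U.norm_map }
  have hV : ∀ x, V x = U x := fun _ => rfl
  rw [← integral_sphereMeasure_comp_isometry V
    (fun x => g x * (1 / (1 - inner ℂ x z) ^ n))]
  refine integral_congr_ae (Filter.Eventually.of_forall fun ζ => ?_)
  simp only [hV]
  congr 4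
  conv_lhs => rw [← hU]
  rw [U.inner_map_map]
  simp [EuclideanSpace.inner_single_right]

/-! ### The Poisson-Szegő kernel. -/

theorem re_one_sub_inner_pos {n : ℕ} {z x : CSpace n} (h : ‖z‖ * ‖x‖ < 1) :
    0 < (1 - inner ℂ z x).re := by
  have h1 := (Complex.re_le_norm (inner ℂ z x)).trans (norm_inner_le_norm z x)
  simp only [Complex.sub_re, Complex.one_re]
  linarith

theorem one_sub_inner_ne_zero {n : ℕ} {z x : CSpace n} (h : ‖z‖ * ‖x‖ < 1) :
    1 - inner ℂ z x ≠ 0 := fun h0 => by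
  have := re_one_sub_inner_pos h
  simp [h0] at this

theorem differentiable_inner_right {n : ℕ} (z : CSpace n) :
    Differentiable ℂ fun x : CSpace n => inner ℂ z x :=
  (innerSL ℂ z).differentiable

theorem differentiableOn_div_one_sub_inner {n : ℕ} (c : ℂ) {z : CSpace n} {s : Set (CSpace n)}
    (h : ∀ x ∈ s, ‖z‖ * ‖x‖ < 1) :
    DifferentiableOn ℂ (fun x => c / (1 - inner ℂ z x)) s := by
  simp only [div_eq_mul_inv]
  exact (((differentiable_inner_right z).const_sub 1).differentiableOn.fun_inv
    fun x hx => one_sub_inner_ne_zero (h x hx)).const_mul c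

/-- With `s = ‖z‖`, this is a radius beyond `1` on which `1 - ⟨x, z⟩` still has no zero; unlike `1 /
s`, it also serves `s = 0`. -/
theorem one_lt_two_div_one_add {s : ℝ} (hs0 : 0 ≤ s) (hs : s < 1) : 1 < 2 / (1 + s) := by
  rw [lt_div_iff₀ (by linarith)]
  linarith

theorem mul_lt_one_of_lt_two_div {s t : ℝ} (hs0 : 0 ≤ s) (hs : s < 1) (ht : t < 2 / (1 + s)) :
    s * t < 1 := by
  rw [lt_div_iff₀ (by linarith)] at ht
  rcases le_or_gt t 0 with h | h
  · nlinarith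
  · nlinarith

/-- The Poisson-Szegő kernel of the unit ball of `ℂⁿ`. -/
noncomputable def poissonSzego {n : ℕ} (z ζ : CSpace n) : ℝ :=
  ((1 - ‖z‖ ^ 2) / ‖1 - inner ℂ z ζ‖ ^ 2) ^ n

/-- The Szegő formula is applied to `u` times the holomorphic factor `((1 - ‖z‖ ^ 2) / (1 - ⟨x, z⟩))
^ n`. The factor is `1` at `x = z`, and on the sphere its product with the Szegő kernel is the
Poisson-Szegő kernel. -/
theorem integral_mul_poissonSzego {n : ℕ} (hn : 1 ≤ n) {R : ℝ} (hR : 1 < R)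
    {u : CSpace n → ℂ} (hu : DifferentiableOn ℂ u (ball 0 R)) {z : CSpace n} (hz : ‖z‖ < 1) :
    ∫ ζ : sphere (0 : CSpace n) 1, u ζ * (poissonSzego z (ζ : CSpace n) : ℂ)
      ∂(sphereMeasure n) = u z := by
  have hz2 : ‖z‖ * ‖z‖ < 1 := by nlinarith [norm_nonneg z]
  have hR' : 1 < min R (2 / (1 + ‖z‖)) :=
    lt_min hR (one_lt_two_div_one_add (norm_nonneg z) hz)
  have hg : DifferentiableOn ℂ
      (fun x => u x * ((1 - (‖z‖ : ℂ) ^ 2) / (1 - inner ℂ z x)) ^ n)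
      (ball 0 (min R (2 / (1 + ‖z‖)))) := by
    refine (hu.mono (ball_subset_ball (min_le_left _ _))).mul (DifferentiableOn.pow ?_ n)
    exact differentiableOn_div_one_sub_inner _ fun x hx => mul_lt_one_of_lt_two_div (norm_nonneg z) hz
      ((mem_ball_zero_iff.1 hx).trans_le (min_le_right _ _))
  have h := szego_formula hn hR' hg hz
  have hzz : 1 - inner ℂ z z = 1 - (‖z‖ : ℂ) ^ 2 := by
    rw [inner_self_eq_norm_sq_to_K]
    rfl
  rw [← hzz, div_self (one_sub_inner_ne_zero hz2), one_pow, mul_one, hzz] at h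
  rw [← h]
  refine integral_congr_ae (Filter.Eventually.of_forall fun ζ => ?_)
  simp only [poissonSzego]
  have hc : 1 - inner ℂ (ζ : CSpace n) z = starRingEnd ℂ (1 - inner ℂ z (ζ : CSpace n)) := by
    rw [map_sub, map_one, inner_conj_symm]
  rw [hc, mul_assoc, one_div, ← inv_pow, ← mul_pow]
  congr 1
  push_cast
  rw [← Complex.mul_conj']
  congr 1
  rw [div_eq_mul_inv, div_eq_mul_inv, mul_inv, mul_assoc]

theorem continuous_poissonSzego {n : ℕ} {z : CSpace n} (hz : ‖z‖ < 1) :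
    Continuous fun ζ : sphere (0 : CSpace n) 1 => poissonSzego z (ζ : CSpace n) := by
  unfold poissonSzego
  refine (Continuous.div continuous_const ?_ fun ζ => ?_).pow n
  · exact ((continuous_const.sub
      ((differentiable_inner_right z).continuous.comp continuous_subtype_val)).norm.pow 2)
  · exact pow_ne_zero _ (norm_ne_zero_iff.2 (one_sub_inner_ne_zero (by simpa using hz)))

theorem poissonSzego_pos {n : ℕ} {z : CSpace n} (hz : ‖z‖ < 1) (ζ : sphere (0 : CSpace n) 1) :
    0 < poissonSzego z (ζ : CSpace n) := by
  have h1 : 0 < ‖1 - inner ℂ z (ζ : CSpace n)‖ :=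
    norm_pos_iff.2 (one_sub_inner_ne_zero (by simpa using hz))
  have h2 : 0 < 1 - ‖z‖ ^ 2 := by nlinarith [norm_nonneg z]
  unfold poissonSzego
  positivity

theorem integral_poissonSzego {n : ℕ} (hn : 1 ≤ n) {z : CSpace n} (hz : ‖z‖ < 1) :
    ∫ ζ : sphere (0 : CSpace n) 1, poissonSzego z (ζ : CSpace n) ∂(sphereMeasure n) = 1 := by
  have := integral_mul_poissonSzego hn one_lt_two (u := fun _ => 1)
    (differentiableOn_const _) hz
  simp only [one_mul] at this
  rw [integral_complex_ofReal] at this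
  exact_mod_cast this

/-! ### Strict convexity of `‖w‖ ^ p` at `1`, quantitatively. -/

/-- The gap in the tangent inequality at `1` of the convex function `w ↦ ‖w‖ ^ p`. -/
noncomputable def rpowGap (p : ℝ) (w : ℂ) : ℝ := ‖w‖ ^ p - 1 - p * (w - 1).re

/-- Off the unit circle Bernoulli's inequality in `‖w‖` is strict; on it, `w.re < 1` unless `w = 1`.
-/
theorem rpowGap_pos {p : ℝ} (hp : 1 < p) {w : ℂ} (hw : w ≠ 1) : 0 < rpowGap p w := by
  have hre := Complex.re_le_norm w
  unfold rpowGap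
  rw [Complex.sub_re, Complex.one_re]
  by_cases h : ‖w‖ = 1
  · have hlt : w.re < 1 := by
      refine lt_of_le_of_ne (h ▸ hre) fun h1 => hw ?_
      have h2 := Complex.sq_norm w
      rw [h, Complex.normSq_apply, h1] at h2
      exact Complex.ext h1 (by simpa using (by linarith : w.im * w.im = 0))
    rw [h, Real.one_rpow]
    nlinarith
  · have := one_add_mul_self_lt_rpow_one_add (s := ‖w‖ - 1) (by linarith [norm_nonneg w])
      (sub_ne_zero.2 h) hp
    rw [add_sub_cancel] at this
    nlinarith

theorem rpowGap_nonneg {p : ℝ} (hp : 1 < p) (w : ℂ) : 0 ≤ rpowGap p w := by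
  rcases eq_or_ne w 1 with rfl | hw
  · simp [rpowGap]
  · exact (rpowGap_pos hp hw).le

theorem continuous_rpowGap {p : ℝ} (hp : 1 < p) : Continuous (rpowGap p) := by
  have : Continuous fun w : ℂ => ‖w‖ ^ p :=
    continuous_norm.rpow_const fun _ => Or.inr (by linarith)
  unfold rpowGap
  fun_prop

/-- By compactness the gap has a positive minimum on the circle of radius `ε` about `1`; by
convexity it grows at least linearly along rays from `1` beyond that circle. -/
theorem exists_norm_sub_one_le_rpowGap {p : ℝ} (hp : 1 < p) {ε : ℝ} (hε : 0 < ε) :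
    ∃ K : ℝ, 0 ≤ K ∧ ∀ w : ℂ, ‖w - 1‖ ≤ ε + K * rpowGap p w := by
  obtain ⟨w₀, hw₀, hmin⟩ := (isCompact_sphere (1 : ℂ) ε).exists_isMinOn
    ((NormedSpace.sphere_nonempty).2 hε.le) (continuous_rpowGap hp).continuousOn
  have hw₀' : ‖w₀ - 1‖ = ε := by simpa [dist_eq_norm] using hw₀
  have hδ : 0 < rpowGap p w₀ := rpowGap_pos hp (by
    rintro rfl
    simp at hw₀'
    exact hε.ne hw₀')
  refine ⟨ε / rpowGap p w₀, by positivity, fun w => ?_⟩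
  rcases le_or_gt ‖w - 1‖ ε with h | h
  · have := rpowGap_nonneg hp w
    have : 0 ≤ ε / rpowGap p w₀ * rpowGap p w := by positivity
    linarith
  set d := ‖w - 1‖
  have hd : 0 < d := hε.trans h
  -- With this `t` the point `1 + t * (w - 1)` lies on the circle where the minimum was taken.
  set t : ℝ := ε / d
  have ht0 : 0 < t := by positivity
  have ht1 : t ≤ 1 := (div_le_one hd).2 h.le
  have h1 : rpowGap p w₀ ≤ rpowGap p (1 + t * (w - 1)) := by
    refine hmin ?_
    simp only [mem_sphere_iff_norm, add_sub_cancel_left, norm_mul, Complex.norm_real,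
      Real.norm_eq_abs, abs_of_pos ht0]
    exact div_mul_cancel₀ _ hd.ne'
  have h2 : rpowGap p (1 + t * (w - 1)) ≤ t * rpowGap p w := by
    have hn : ‖1 + t * (w - 1)‖ ≤ (1 - t) * 1 + t * ‖w‖ := by
      have : (1 + t * (w - 1) : ℂ) = ((1 - t : ℝ) : ℂ) + (t : ℂ) * w := by
        push_cast
        ring
      rw [this]
      refine (norm_add_le _ _).trans ?_
      rw [norm_mul, Complex.norm_real, Complex.norm_real, Real.norm_of_nonneg ht0.le,
        Real.norm_of_nonneg (by linarith), mul_one]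
    have hc := (convexOn_rpow hp.le).2 (mem_Ici.2 zero_le_one) (mem_Ici.2 (norm_nonneg w))
      (by linarith : 0 ≤ 1 - t) ht0.le (by ring)
    simp only [smul_eq_mul, Real.one_rpow] at hc
    have := (Real.rpow_le_rpow (norm_nonneg _) hn (by linarith)).trans hc
    have hr : (1 + t * (w - 1) - 1 : ℂ).re = t * (w - 1).re := by
      rw [add_sub_cancel_left, Complex.re_ofReal_mul]
    unfold rpowGap
    rw [hr]
    linarith
  have h3 := h1.trans h2
  have : d ≤ ε / rpowGap p w₀ * rpowGap p w := by
    rw [div_mul_eq_mul_div, le_div_iff₀ hδ]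
    calc d * rpowGap p w₀ ≤ d * (t * rpowGap p w) := by gcongr
      _ = ε * rpowGap p w := by simp only [t]; field_simp
  linarith

/-! ### The extremal function. -/

theorem norm_mul_lt_one {n : ℕ} {z x : CSpace n} (hz : ‖z‖ < 1) (hx : ‖x‖ ≤ 1) :
    ‖z‖ * ‖x‖ < 1 :=
  (mul_le_of_le_one_right (norm_nonneg _) hx).trans_lt hz

theorem one_sub_norm_sq_pos {n : ℕ} {z : CSpace n} (hz : ‖z‖ < 1) : 0 < 1 - ‖z‖ ^ 2 := by
  nlinarith [norm_nonneg z]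

theorem kernel_base_mem_slitPlane {n : ℕ} {z x : CSpace n} (hz : ‖z‖ < 1)
    (hx : ‖z‖ * ‖x‖ < 1) : (1 - (‖z‖ : ℂ) ^ 2) / (1 - inner ℂ z x) ∈ Complex.slitPlane := by
  left
  have h1 := re_one_sub_inner_pos hx
  have h2 := one_sub_norm_sq_pos hz
  have h3 : 0 < Complex.normSq (1 - inner ℂ z x) :=
    Complex.normSq_pos.2 (one_sub_inner_ne_zero hx)
  have h4 : (1 - (‖z‖ : ℂ) ^ 2) = ((1 - ‖z‖ ^ 2 : ℝ) : ℂ) := by push_cast; rfl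
  rw [h4, div_eq_mul_inv, Complex.re_ofReal_mul, Complex.inv_re]
  positivity

theorem differentiableOn_fMin {n : ℕ} (p : ℝ) {z₀ : CSpace n} (hz₀ : ‖z₀‖ < 1) (w₀ : ℂ)
    {s : Set (CSpace n)} (hs : ∀ x ∈ s, ‖z₀‖ * ‖x‖ < 1) :
    DifferentiableOn ℂ (fMin p z₀ w₀) s :=
  ((differentiableOn_div_one_sub_inner _ hs).cpow (differentiableOn_const _)
    fun x hx => kernel_base_mem_slitPlane hz₀ (hs x hx)).const_mul w₀

theorem fMin_ne_zero {n : ℕ} (p : ℝ) {z₀ x : CSpace n} (hz₀ : ‖z₀‖ < 1) {w₀ : ℂ} (hw₀ : w₀ ≠ 0)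
    (hx : ‖z₀‖ * ‖x‖ < 1) : fMin p z₀ w₀ x ≠ 0 := by
  refine mul_ne_zero hw₀ fun h => ?_
  exact Complex.slitPlane_ne_zero (kernel_base_mem_slitPlane hz₀ hx)
    ((Complex.cpow_eq_zero_iff _ _).1 h).1

theorem fMin_self {n : ℕ} (p : ℝ) {z₀ : CSpace n} (hz₀ : ‖z₀‖ < 1) (w₀ : ℂ) :
    fMin p z₀ w₀ z₀ = w₀ := by
  have h : (inner ℂ z₀ z₀ : ℂ) = (‖z₀‖ : ℂ) ^ 2 := by
    rw [inner_self_eq_norm_sq_to_K]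
    rfl
  have h0 := one_sub_inner_ne_zero (norm_mul_lt_one hz₀ hz₀.le)
  rw [h] at h0
  rw [fMin, h, div_self h0, Complex.one_cpow, mul_one]

theorem norm_fMin_rpow {n : ℕ} {p : ℝ} (hp : 1 < p) {z₀ x : CSpace n} (hz₀ : ‖z₀‖ < 1) (w₀ : ℂ) :
    ‖fMin p z₀ w₀ x‖ ^ p =
      ‖w₀‖ ^ p * ((1 - ‖z₀‖ ^ 2) ^ 2 / ‖1 - inner ℂ z₀ x‖ ^ 2) ^ n := by
  have h2 := one_sub_norm_sq_pos hz₀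
  have h4 : (1 - (‖z₀‖ : ℂ) ^ 2) = ((1 - ‖z₀‖ ^ 2 : ℝ) : ℂ) := by push_cast; rfl
  rw [fMin, norm_mul, Real.mul_rpow (norm_nonneg _) (norm_nonneg _), Complex.norm_cpow_real,
    ← Real.rpow_mul (norm_nonneg _), div_mul_cancel₀ _ (by linarith : p ≠ 0), norm_div, h4,
    Complex.norm_real, Real.norm_of_nonneg h2.le, ← div_pow, ← pow_mul]
  congr 1
  rw [← Real.rpow_natCast ((1 - ‖z₀‖ ^ 2) / ‖1 - inner ℂ z₀ x‖) (2 * n)]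
  push_cast
  rfl

/-- A real factor moves across the inner product from `x` to `z₀`. The mean over radius `r` is then
known, since the kernel at `r • z₀` has integral `1`. -/
theorem norm_fMin_rpow_smul {n : ℕ} {p : ℝ} (hp : 1 < p) {z₀ : CSpace n} (hz₀ : ‖z₀‖ < 1)
    (w₀ : ℂ) {r : ℝ} (hr : |r| ≤ 1) (x : CSpace n) :
    ‖fMin p z₀ w₀ (r • x)‖ ^ p =
      ‖w₀‖ ^ p * ((1 - ‖z₀‖ ^ 2) ^ 2 / (1 - ‖r • z₀‖ ^ 2)) ^ n * poissonSzego (r • z₀) x := by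
  have h1 : ‖r • z₀‖ < 1 := by
    rw [norm_smul]
    exact (mul_le_of_le_one_left (norm_nonneg _) hr).trans_lt hz₀
  have h2 := one_sub_norm_sq_pos h1
  have h3 : (inner ℂ z₀ (r • x) : ℂ) = inner ℂ (r • z₀) x := by
    rw [← Complex.coe_smul, ← Complex.coe_smul, inner_smul_left, inner_smul_right,
      Complex.conj_ofReal]
  rw [norm_fMin_rpow hp hz₀, poissonSzego, h3, mul_assoc, ← mul_pow, div_mul_div_cancel₀ h2.ne']

theorem norm_fMin_rpow_eq_poissonSzego {n : ℕ} {p : ℝ} (hp : 1 < p) {z₀ : CSpace n}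
    (hz₀ : ‖z₀‖ < 1) (w₀ : ℂ) (x : CSpace n) :
    ‖fMin p z₀ w₀ x‖ ^ p = ‖w₀‖ ^ p * (1 - ‖z₀‖ ^ 2) ^ n * poissonSzego z₀ x := by
  have h := norm_fMin_rpow_smul hp hz₀ w₀ (r := 1) (by simp) x
  rw [one_smul, one_smul, sq (1 - ‖z₀‖ ^ 2), mul_div_cancel_right₀ _
    (one_sub_norm_sq_pos hz₀).ne'] at h
  exact h

/-! ### Dilates and the Hardy norm as a bound on means. -/

theorem dilate_mem_ball {n : ℕ} {r : ℝ} (hr : r ∈ Ioo (0 : ℝ) 1) {x : CSpace n} (hx : ‖x‖ < r⁻¹) :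
    r • x ∈ ball (0 : CSpace n) 1 := by
  rw [mem_ball_zero_iff, norm_smul, Real.norm_of_nonneg hr.1.le]
  calc r * ‖x‖ < r * r⁻¹ := mul_lt_mul_of_pos_left hx hr.1
    _ = 1 := mul_inv_cancel₀ hr.1.ne'

theorem differentiableOn_dilate {n : ℕ} {f : CSpace n → ℂ} (hf : DifferentiableOn ℂ f (ball 0 1))
    {r : ℝ} (hr : r ∈ Ioo (0 : ℝ) 1) :
    DifferentiableOn ℂ (fun x => f (r • x)) (ball 0 r⁻¹) :=
  hf.comp (Differentiable.differentiableOn (by fun_prop)) fun x hx =>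
    dilate_mem_ball hr (mem_ball_zero_iff.1 hx)

theorem continuous_sphere_of_differentiableOn {n : ℕ} {R : ℝ} (hR : 1 < R) {u : CSpace n → ℂ}
    (hu : DifferentiableOn ℂ u (ball 0 R)) :
    Continuous fun ζ : sphere (0 : CSpace n) 1 => u ζ :=
  hu.continuousOn.comp_continuous continuous_subtype_val fun ζ => by simpa using hR

theorem continuous_norm_rpow_of_pos {X : Type*} [TopologicalSpace X] {u : X → ℂ}
    (hu : Continuous u) {p : ℝ} (hp : 0 < p) : Continuous fun x => ‖u x‖ ^ p :=
  hu.norm.rpow_const fun _ => Or.inr hp.le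

theorem hardyNorm_le_ofReal_iff {n : ℕ} (hn : 1 ≤ n) {p : ℝ} (hp : 1 < p) {f : CSpace n → ℂ}
    (hf : DifferentiableOn ℂ f (ball 0 1)) {C : ℝ} (hC : 0 ≤ C) :
    hardyNorm p f ≤ ENNReal.ofReal C ↔ ∀ r ∈ Ioo (0 : ℝ) 1,
      ∫ ζ : sphere (0 : CSpace n) 1, ‖f (r • (ζ : CSpace n))‖ ^ p ∂(sphereMeasure n) ≤ C ^ p := by
  have hp0 : 0 < p := by linarith
  simp only [hardyNorm, iSup_le_iff]
  refine forall₂_congr fun r hr => ?_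
  have hc := continuous_norm_rpow_of_pos (continuous_sphere_of_differentiableOn
    ((one_lt_inv₀ hr.1).2 hr.2) (differentiableOn_dilate hf hr)) hp0
  have h1 : ∫⁻ ζ : sphere (0 : CSpace n) 1, ‖f (r • (ζ : CSpace n))‖ₑ ^ p ∂(sphereMeasure n) =
      ENNReal.ofReal (∫ ζ : sphere (0 : CSpace n) 1, ‖f (r • (ζ : CSpace n))‖ ^ p
        ∂(sphereMeasure n)) := by
    rw [ofReal_integral_eq_lintegral_ofReal (continuous_integrable_sphereMeasure hn hc)
      (Eventually.of_forall fun ζ => by positivity)]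
    refine lintegral_congr fun ζ => ?_
    rw [← ENNReal.ofReal_rpow_of_nonneg (norm_nonneg _) hp0.le, ofReal_norm]
  have h2 : 0 ≤ ∫ ζ : sphere (0 : CSpace n) 1, ‖f (r • (ζ : CSpace n))‖ ^ p ∂(sphereMeasure n) :=
    integral_nonneg fun ζ => by positivity
  rw [h1, ENNReal.ofReal_rpow_of_nonneg h2 (by positivity), ENNReal.ofReal_le_ofReal_iff hC,
    one_div, Real.rpow_inv_le_iff_of_pos h2 hC hp0]

/-! ### Poisson-Szegő averages of a holomorphic function near `1`. -/

/-- Jensen's inequality for `‖·‖ ^ p` and the Poisson-Szegő measure, with its exact defect. -/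
theorem integral_norm_rpow_mul_poissonSzego {n : ℕ} (hn : 1 ≤ n) {p : ℝ} (hp : 1 < p) {R : ℝ}
    (hR : 1 < R) {u : CSpace n → ℂ} (hu : DifferentiableOn ℂ u (ball 0 R)) {z : CSpace n}
    (hz : ‖z‖ < 1) :
    ∫ ζ : sphere (0 : CSpace n) 1, ‖u ζ‖ ^ p * poissonSzego z (ζ : CSpace n) ∂(sphereMeasure n) =
      1 + p * (u z - 1).re + ∫ ζ : sphere (0 : CSpace n) 1,
        rpowGap p (u ζ) * poissonSzego z (ζ : CSpace n) ∂(sphereMeasure n) := by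
  have hP := continuous_poissonSzego hz
  have huc := continuous_sphere_of_differentiableOn hR hu
  have h1 : ∫ ζ : sphere (0 : CSpace n) 1, (u ζ - 1).re * poissonSzego z (ζ : CSpace n)
      ∂(sphereMeasure n) = (u z - 1).re := by
    rw [← integral_mul_poissonSzego hn hR (u := fun x => u x - 1) (hu.sub_const 1) hz]
    have := integral_re (continuous_integrable_sphereMeasure hn
      (F := fun ζ : sphere (0 : CSpace n) 1 => (u ζ - 1) * (poissonSzego z (ζ : CSpace n) : ℂ))
      ((huc.sub continuous_const).mul (Complex.continuous_ofReal.comp hP)))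
    simp only [RCLike.re_eq_complex_re, Complex.re_mul_ofReal] at this
    exact this
  have h2 := integral_poissonSzego hn hz
  have i1 : Integrable (fun ζ : sphere (0 : CSpace n) 1 => poissonSzego z (ζ : CSpace n))
      (sphereMeasure n) := continuous_integrable_sphereMeasure hn hP
  have i2 : Integrable (fun ζ : sphere (0 : CSpace n) 1 =>
      p * ((u ζ - 1).re * poissonSzego z (ζ : CSpace n))) (sphereMeasure n) :=
    continuous_integrable_sphereMeasure hn (continuous_const.mul
      ((Complex.continuous_re.comp (huc.sub continuous_const)).mul hP))
  have i3 : Integrable (fun ζ : sphere (0 : CSpace n) 1 =>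
      rpowGap p (u ζ) * poissonSzego z (ζ : CSpace n)) (sphereMeasure n) :=
    continuous_integrable_sphereMeasure hn (((continuous_rpowGap hp).comp huc).mul hP)
  calc _ = ∫ ζ : sphere (0 : CSpace n) 1, (poissonSzego z (ζ : CSpace n) +
        p * ((u ζ - 1).re * poissonSzego z (ζ : CSpace n)) +
        rpowGap p (u ζ) * poissonSzego z (ζ : CSpace n)) ∂(sphereMeasure n) := by
        refine integral_congr_ae (Eventually.of_forall fun ζ => ?_)
        simp only [rpowGap]
        ring
    _ = _ := by
        rw [integral_add (by exact i1.add i2) i3, integral_add i1 i2, integral_const_mul, h1, h2]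

theorem integral_norm_sub_one_mul_poissonSzego_le {n : ℕ} (hn : 1 ≤ n) {p : ℝ} (hp : 1 < p)
    {R : ℝ} (hR : 1 < R) {u : CSpace n → ℂ} (hu : DifferentiableOn ℂ u (ball 0 R))
    {z : CSpace n} (hz : ‖z‖ < 1) {ε K : ℝ} (hK : ∀ w : ℂ, ‖w - 1‖ ≤ ε + K * rpowGap p w) :
    ∫ ζ : sphere (0 : CSpace n) 1, ‖u ζ - 1‖ * poissonSzego z (ζ : CSpace n) ∂(sphereMeasure n) ≤
      ε + K * ∫ ζ : sphere (0 : CSpace n) 1,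
        rpowGap p (u ζ) * poissonSzego z (ζ : CSpace n) ∂(sphereMeasure n) := by
  have hP := continuous_poissonSzego hz
  have huc := continuous_sphere_of_differentiableOn hR hu
  have h2 := integral_poissonSzego hn hz
  have i1 : Integrable (fun ζ : sphere (0 : CSpace n) 1 => ε * poissonSzego z (ζ : CSpace n))
      (sphereMeasure n) := continuous_integrable_sphereMeasure hn (continuous_const.mul hP)
  have i2 : Integrable (fun ζ : sphere (0 : CSpace n) 1 =>
      K * (rpowGap p (u ζ) * poissonSzego z (ζ : CSpace n))) (sphereMeasure n) :=
    continuous_integrable_sphereMeasure hn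
      (continuous_const.mul (((continuous_rpowGap hp).comp huc).mul hP))
  calc _ ≤ ∫ ζ : sphere (0 : CSpace n) 1, (ε * poissonSzego z (ζ : CSpace n) +
        K * (rpowGap p (u ζ) * poissonSzego z (ζ : CSpace n))) ∂(sphereMeasure n) := by
        refine integral_mono
          (continuous_integrable_sphereMeasure hn ((huc.sub continuous_const).norm.mul hP))
          (i1.add i2) fun ζ => ?_
        have := mul_le_mul_of_nonneg_right (hK (u ζ)) (poissonSzego_pos hz ζ).le
        simp only
        linarith
    _ = _ := by
        rw [integral_add i1 i2, integral_const_mul, integral_const_mul, h2, mul_one]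

/-- A Harnack inequality: the quotient of two positive continuous kernels is bounded on the compact
sphere. -/
theorem exists_poissonSzego_le_mul {n : ℕ} {z z₀ : CSpace n} (hz : ‖z‖ < 1) (hz₀ : ‖z₀‖ < 1) :
    ∃ C : ℝ, 0 < C ∧ ∀ ζ : sphere (0 : CSpace n) 1,
      poissonSzego z (ζ : CSpace n) ≤ C * poissonSzego z₀ (ζ : CSpace n) := by
  have hc := (continuous_poissonSzego hz).div (continuous_poissonSzego hz₀)
    fun ζ => (poissonSzego_pos hz₀ ζ).ne'
  obtain ⟨C, hC⟩ := isCompact_univ.exists_bound_of_continuousOn hc.continuousOn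
  refine ⟨max C 1, by positivity, fun ζ => ?_⟩
  rw [← div_le_iff₀ (poissonSzego_pos hz₀ ζ)]
  exact ((le_abs_self _).trans (hC ζ (mem_univ ζ))).trans (le_max_left _ _)

theorem norm_sub_one_le_integral_poissonSzego {n : ℕ} (hn : 1 ≤ n) {R : ℝ} (hR : 1 < R)
    {u : CSpace n → ℂ} (hu : DifferentiableOn ℂ u (ball 0 R)) {z z₀ : CSpace n} (hz : ‖z‖ < 1)
    (hz₀ : ‖z₀‖ < 1) {C : ℝ} (hC : ∀ ζ : sphere (0 : CSpace n) 1,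
      poissonSzego z (ζ : CSpace n) ≤ C * poissonSzego z₀ (ζ : CSpace n)) :
    ‖u z - 1‖ ≤ C * ∫ ζ : sphere (0 : CSpace n) 1,
      ‖u ζ - 1‖ * poissonSzego z₀ (ζ : CSpace n) ∂(sphereMeasure n) := by
  have huc := continuous_sphere_of_differentiableOn hR hu
  rw [← integral_mul_poissonSzego hn hR (u := fun x => u x - 1) (hu.sub_const 1) hz,
    ← integral_const_mul]
  refine norm_integral_le_of_norm_le (continuous_integrable_sphereMeasure hn
    (continuous_const.mul ((huc.sub continuous_const).norm.mul (continuous_poissonSzego hz₀))))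
    (Eventually.of_forall fun ζ => ?_)
  rw [norm_mul, Complex.norm_real, Real.norm_of_nonneg (poissonSzego_pos hz ζ).le, mul_left_comm]
  exact mul_le_mul_of_nonneg_left (hC ζ) (norm_nonneg _)

theorem tendsto_dilate {n : ℕ} {f : CSpace n → ℂ} (hf : DifferentiableOn ℂ f (ball 0 1))
    {z : CSpace n} (hz : ‖z‖ < 1) :
    Tendsto (fun r : ℝ => f (r • z)) (𝓝[<] 1) (𝓝 (f z)) := by
  have h1 : ContinuousAt f ((1 : ℝ) • z) := by
    rw [one_smul]
    exact hf.continuousOn.continuousAt (isOpen_ball.mem_nhds (by simpa using hz))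
  have h2 : Tendsto (fun r : ℝ => r • z) (𝓝[<] 1) (𝓝 ((1 : ℝ) • z)) :=
    ((continuous_id.smul continuous_const).tendsto 1).mono_left nhdsWithin_le_nhds
  simpa [Function.comp_def] using h1.tendsto.comp h2

/-- The quotient of a dilate of `f` by the extremal function. -/
theorem differentiableOn_dilate_div_fMin {n : ℕ} {p : ℝ} {f : CSpace n → ℂ}
    (hf : DifferentiableOn ℂ f (ball 0 1)) {z₀ : CSpace n} (hz₀ : ‖z₀‖ < 1) {w₀ : ℂ}
    (hw₀ : w₀ ≠ 0) {r : ℝ} (hr : r ∈ Ioo (0 : ℝ) 1) :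
    DifferentiableOn ℂ (fun x => f (r • x) / fMin p z₀ w₀ x)
      (ball 0 (min r⁻¹ (2 / (1 + ‖z₀‖)))) := by
  have hx : ∀ x ∈ ball (0 : CSpace n) (min r⁻¹ (2 / (1 + ‖z₀‖))), ‖z₀‖ * ‖x‖ < 1 :=
    fun x hx => mul_lt_one_of_lt_two_div (norm_nonneg z₀) hz₀
      ((mem_ball_zero_iff.1 hx).trans_le (min_le_right _ _))
  simp only [div_eq_mul_inv]
  exact ((differentiableOn_dilate hf hr).mono (ball_subset_ball (min_le_left _ _))).mul
    ((differentiableOn_fMin p hz₀ w₀ hx).fun_inv fun x h => fMin_ne_zero p hz₀ hw₀ (hx x h))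

theorem one_lt_min_radius {n : ℕ} {z₀ : CSpace n} (hz₀ : ‖z₀‖ < 1) {r : ℝ}
    (hr : r ∈ Ioo (0 : ℝ) 1) : 1 < min r⁻¹ (2 / (1 + ‖z₀‖)) :=
  lt_min ((one_lt_inv₀ hr.1).2 hr.2) (one_lt_two_div_one_add (norm_nonneg z₀) hz₀)

/-- The exact Jensen identity for the quotient by `fMin`, whose `p`-th power modulus supplies the
kernel. Dropping the gap gives the lower bound; keeping it gives uniqueness. -/
theorem integral_norm_dilate_rpow {n : ℕ} (hn : 1 ≤ n) {p : ℝ} (hp : 1 < p) {f : CSpace n → ℂ}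
    (hf : DifferentiableOn ℂ f (ball 0 1)) {z₀ : CSpace n} (hz₀ : ‖z₀‖ < 1) {w₀ : ℂ}
    (hw₀ : w₀ ≠ 0) {r : ℝ} (hr : r ∈ Ioo (0 : ℝ) 1) :
    ∫ ζ : sphere (0 : CSpace n) 1, ‖f (r • (ζ : CSpace n))‖ ^ p ∂(sphereMeasure n) =
      ‖w₀‖ ^ p * (1 - ‖z₀‖ ^ 2) ^ n * (1 + p * (f (r • z₀) / w₀ - 1).re +
        ∫ ζ : sphere (0 : CSpace n) 1, rpowGap p (f (r • (ζ : CSpace n)) / fMin p z₀ w₀ ζ) *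
          poissonSzego z₀ (ζ : CSpace n) ∂(sphereMeasure n)) := by
  have h := integral_norm_rpow_mul_poissonSzego hn hp (one_lt_min_radius hz₀ hr)
    (differentiableOn_dilate_div_fMin (p := p) hf hz₀ hw₀ hr) hz₀
  rw [fMin_self p hz₀] at h
  rw [← h, ← integral_const_mul]
  refine integral_congr_ae (Eventually.of_forall fun ζ => ?_)
  have h0 : 0 < ‖fMin p z₀ w₀ (ζ : CSpace n)‖ :=
    norm_pos_iff.2 (fMin_ne_zero p hz₀ hw₀ (by simpa using hz₀))
  have h1 := norm_fMin_rpow_eq_poissonSzego hp hz₀ w₀ (ζ : CSpace n)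
  have h2 : ‖fMin p z₀ w₀ (ζ : CSpace n)‖ ^ p ≠ 0 := (Real.rpow_pos_of_pos h0 p).ne'
  simp only
  rw [norm_div, Real.div_rpow (norm_nonneg _) h0.le, mul_left_comm, ← h1, div_mul_cancel₀ _ h2]

theorem tendsto_dilate_div_sub_one {n : ℕ} {f : CSpace n → ℂ}
    (hf : DifferentiableOn ℂ f (ball 0 1)) {z : CSpace n} (hz : ‖z‖ < 1) (w : ℂ) :
    Tendsto (fun r : ℝ => f (r • z) / w - 1) (𝓝[<] 1) (𝓝 (f z / w - 1)) :=
  ((tendsto_dilate hf hz).div_const w).sub_const 1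

theorem eventually_mem_Ioo_zero_one : ∀ᶠ r : ℝ in 𝓝[<] 1, r ∈ Ioo (0 : ℝ) 1 :=
  Ioo_mem_nhdsLT one_pos

/-! ### The minimal norm. -/

theorem le_rpow_of_hardyNorm_le {n : ℕ} (hn : 1 ≤ n) {p : ℝ} (hp : 1 < p) {f : CSpace n → ℂ}
    (hf : DifferentiableOn ℂ f (ball 0 1)) {z₀ : CSpace n} (hz₀ : ‖z₀‖ < 1) {w₀ : ℂ}
    (hw₀ : w₀ ≠ 0) (hfz : f z₀ = w₀) {C : ℝ} (hC : 0 ≤ C)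
    (hfC : hardyNorm p f ≤ ENNReal.ofReal C) : ‖w₀‖ ^ p * (1 - ‖z₀‖ ^ 2) ^ n ≤ C ^ p := by
  rw [hardyNorm_le_ofReal_iff hn hp hf hC] at hfC
  have hM : 0 ≤ ‖w₀‖ ^ p * (1 - ‖z₀‖ ^ 2) ^ n := by
    have := one_sub_norm_sq_pos hz₀
    positivity
  have hlim : Tendsto (fun r : ℝ => ‖w₀‖ ^ p * (1 - ‖z₀‖ ^ 2) ^ n *
      (1 + p * (f (r • z₀) / w₀ - 1).re)) (𝓝[<] 1)
      (𝓝 (‖w₀‖ ^ p * (1 - ‖z₀‖ ^ 2) ^ n * (1 + p * (f z₀ / w₀ - 1).re))) :=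
    ((((Complex.continuous_re.tendsto _).comp
      (tendsto_dilate_div_sub_one hf hz₀ w₀)).const_mul p).const_add 1).const_mul _
  rw [hfz, div_self hw₀, sub_self, Complex.zero_re, mul_zero, add_zero, mul_one] at hlim
  refine le_of_tendsto hlim (eventually_mem_Ioo_zero_one.mono fun r hr => ?_)
  refine le_trans ?_ (hfC r hr)
  rw [integral_norm_dilate_rpow hn hp hf hz₀ hw₀ hr]
  refine mul_le_mul_of_nonneg_left (le_add_of_nonneg_right ?_) hM
  exact integral_nonneg fun ζ => mul_nonneg (rpowGap_nonneg hp _) (poissonSzego_pos hz₀ ζ).le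

theorem extremal_value_rpow {n : ℕ} {p : ℝ} (hp : 1 < p) {z₀ : CSpace n} (hz₀ : ‖z₀‖ < 1)
    (w₀ : ℂ) : (‖w₀‖ * (1 - ‖z₀‖ ^ 2) ^ ((n : ℝ) / p)) ^ p = ‖w₀‖ ^ p * (1 - ‖z₀‖ ^ 2) ^ n := by
  have h := one_sub_norm_sq_pos hz₀
  rw [Real.mul_rpow (norm_nonneg _) (by positivity), ← Real.rpow_mul h.le,
    div_mul_cancel₀ _ (by linarith : p ≠ 0), Real.rpow_natCast]

theorem ofReal_extremal_value_le_hardyNorm {n : ℕ} (hn : 1 ≤ n) {p : ℝ} (hp : 1 < p)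
    {f : CSpace n → ℂ} (hf : DifferentiableOn ℂ f (ball 0 1)) {z₀ : CSpace n} (hz₀ : ‖z₀‖ < 1)
    {w₀ : ℂ} (hfz : f z₀ = w₀) :
    ENNReal.ofReal (‖w₀‖ * (1 - ‖z₀‖ ^ 2) ^ ((n : ℝ) / p)) ≤ hardyNorm p f := by
  rcases eq_or_ne w₀ 0 with hw₀ | hw₀
  · simp [hw₀]
  rcases eq_or_ne (hardyNorm p f) ∞ with htop | htop
  · simp [htop]
  have h := le_rpow_of_hardyNorm_le hn hp hf hz₀ hw₀ hfz ENNReal.toReal_nonneg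
    (ENNReal.ofReal_toReal htop).ge
  rw [← extremal_value_rpow hp hz₀ w₀] at h
  have := one_sub_norm_sq_pos hz₀
  exact ENNReal.ofReal_le_of_le_toReal
    ((Real.rpow_le_rpow_iff (by positivity) ENNReal.toReal_nonneg (by linarith)).1 h)

theorem hardyNorm_fMin_le {n : ℕ} (hn : 1 ≤ n) {p : ℝ} (hp : 1 < p) {z₀ : CSpace n}
    (hz₀ : ‖z₀‖ < 1) (w₀ : ℂ) : hardyNorm p (fMin p z₀ w₀) ≤
      ENNReal.ofReal (‖w₀‖ * (1 - ‖z₀‖ ^ 2) ^ ((n : ℝ) / p)) := by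
  have h := one_sub_norm_sq_pos hz₀
  rw [hardyNorm_le_ofReal_iff hn hp (differentiableOn_fMin p hz₀ w₀ fun x hx =>
    norm_mul_lt_one hz₀ (mem_ball_zero_iff.1 hx).le) (by positivity), extremal_value_rpow hp hz₀]
  intro r hr
  have hr1 : |r| ≤ 1 := by
    rw [abs_of_pos hr.1]
    exact hr.2.le
  have hle : ‖r • z₀‖ ≤ ‖z₀‖ := by
    rw [norm_smul]
    exact mul_le_of_le_one_left (norm_nonneg _) hr1
  have h1 := one_sub_norm_sq_pos (hle.trans_lt hz₀)
  simp only [norm_fMin_rpow_smul hp hz₀ w₀ hr1]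
  rw [integral_const_mul, integral_poissonSzego hn (hle.trans_lt hz₀), mul_one]
  refine mul_le_mul_of_nonneg_left (pow_le_pow_left₀ (by positivity) ?_ n) (by positivity)
  -- The comparison reduces to `1 - ‖z₀‖ ^ 2 ≤ 1 - ‖r • z₀‖ ^ 2`.
  rw [div_le_iff₀ h1, sq (1 - ‖z₀‖ ^ 2)]
  refine mul_le_mul_of_nonneg_left ?_ h.le
  gcongr

theorem hardyNorm_fMin {n : ℕ} (hn : 1 ≤ n) {p : ℝ} (hp : 1 < p) {z₀ : CSpace n}
    (hz₀ : ‖z₀‖ < 1) (w₀ : ℂ) : hardyNorm p (fMin p z₀ w₀) =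
      ENNReal.ofReal (‖w₀‖ * (1 - ‖z₀‖ ^ 2) ^ ((n : ℝ) / p)) :=
  (hardyNorm_fMin_le hn hp hz₀ w₀).antisymm
    (ofReal_extremal_value_le_hardyNorm hn hp (differentiableOn_fMin p hz₀ w₀ fun _ hx =>
      norm_mul_lt_one hz₀ (mem_ball_zero_iff.1 hx).le) hz₀ (fMin_self p hz₀ w₀))

/-! ### Uniqueness. -/

/-- This settles `w₀ = 0`, where `fMin` vanishes and cannot serve as a divisor. -/
theorem eq_zero_of_hardyNorm_eq_zero {n : ℕ} (hn : 1 ≤ n) {p : ℝ} (hp : 1 < p)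
    {f : CSpace n → ℂ} (hf : DifferentiableOn ℂ f (ball 0 1)) (h0 : hardyNorm p f = 0)
    {z : CSpace n} (hz : ‖z‖ < 1) : f z = 0 := by
  have hp0 : p ≠ 0 := by linarith
  have h1 := (hardyNorm_le_ofReal_iff hn hp hf le_rfl).1 (by simp [h0])
  refine tendsto_nhds_unique (tendsto_dilate hf hz) (tendsto_const_nhds.congr' ?_)
  refine eventually_mem_Ioo_zero_one.mono fun r hr => ?_
  have hR := (one_lt_inv₀ hr.1).2 hr.2
  have hd := differentiableOn_dilate hf hr
  have h2 := (h1 r hr).trans_eq (Real.zero_rpow hp0)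
  have hnn : ∀ ζ : sphere (0 : CSpace n) 1, 0 ≤ ‖f (r • (ζ : CSpace n))‖ ^ p :=
    fun ζ => by positivity
  have h3 := (integral_eq_zero_iff_of_nonneg hnn (continuous_integrable_sphereMeasure hn
    (continuous_norm_rpow_of_pos (continuous_sphere_of_differentiableOn hR hd)
      (by linarith)))).1 (h2.antisymm (integral_nonneg hnn))
  refine Eq.trans (integral_eq_zero_of_ae (h3.mono fun ζ hζ => ?_)).symm
    (integral_mul_poissonSzego hn hR hd hz)
  have : ‖f (r • (ζ : CSpace n))‖ = 0 :=
    ((Real.rpow_eq_zero_iff_of_nonneg (norm_nonneg _)).1 hζ).1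
  simp [norm_eq_zero.1 this]

theorem eq_fMin_of_hardyNorm_le {n : ℕ} (hn : 1 ≤ n) {p : ℝ} (hp : 1 < p)
    {f : CSpace n → ℂ} (hf : DifferentiableOn ℂ f (ball 0 1)) {z₀ : CSpace n} (hz₀ : ‖z₀‖ < 1)
    {w₀ : ℂ} (hw₀ : w₀ ≠ 0) (hfz : f z₀ = w₀)
    (hle : hardyNorm p f ≤ ENNReal.ofReal (‖w₀‖ * (1 - ‖z₀‖ ^ 2) ^ ((n : ℝ) / p)))
    {z : CSpace n} (hz : ‖z‖ < 1) : f z = fMin p z₀ w₀ z := by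
  have h := one_sub_norm_sq_pos hz₀
  have hw : 0 < ‖w₀‖ := norm_pos_iff.2 hw₀
  have hM : 0 < ‖w₀‖ ^ p * (1 - ‖z₀‖ ^ 2) ^ n := by positivity
  rw [hardyNorm_le_ofReal_iff hn hp hf (by positivity), extremal_value_rpow hp hz₀] at hle
  obtain ⟨C, hC0, hC⟩ := exists_poissonSzego_le_mul hz hz₀
  have hne : fMin p z₀ w₀ z ≠ 0 := fMin_ne_zero p hz₀ hw₀ (norm_mul_lt_one hz₀ hz.le)
  suffices hs : ‖f z / fMin p z₀ w₀ z - 1‖ ≤ 0 from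
    (div_eq_one_iff_eq hne).1 (sub_eq_zero.1 (norm_le_zero_iff.1 hs))
  refine le_of_forall_pos_le_add fun δ hδ => ?_
  -- The tolerance `δ / C` offsets the Harnack constant. `K` depends on `δ` but not on `r`, so `r →
  -- 1` can be taken with `δ` fixed.
  obtain ⟨K, hK0, hK⟩ := exists_norm_sub_one_le_rpowGap hp (div_pos hδ hC0)
  have hlim : Tendsto (fun r : ℝ => C * (δ / C + K * -(p * (f (r • z₀) / w₀ - 1).re))) (𝓝[<] 1)
      (𝓝 (C * (δ / C + K * -(p * (f z₀ / w₀ - 1).re)))) :=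
    (((((Complex.continuous_re.tendsto _).comp
      (tendsto_dilate_div_sub_one hf hz₀ w₀)).const_mul p).neg.const_mul K).const_add _).const_mul C
  rw [hfz, div_self hw₀, sub_self, Complex.zero_re, mul_zero, neg_zero, mul_zero, add_zero,
    mul_div_cancel₀ _ hC0.ne'] at hlim
  rw [zero_add]
  refine le_of_tendsto_of_tendsto (tendsto_dilate_div_sub_one hf hz _).norm hlim
    (eventually_mem_Ioo_zero_one.mono fun r hr => ?_)
  have hR := one_lt_min_radius hz₀ hr
  have hd := differentiableOn_dilate_div_fMin (p := p) hf hz₀ hw₀ hr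
  refine (norm_sub_one_le_integral_poissonSzego hn hR hd hz hz₀ hC).trans
    (mul_le_mul_of_nonneg_left ?_ hC0.le)
  refine (integral_norm_sub_one_mul_poissonSzego_le hn hp hR hd hz₀ hK).trans ?_
  gcongr
  have h1 := hle r hr
  -- Minimality bounds the average gap by `-p Re (f (r • z₀) / w₀ - 1)`, which tends to `0`.
  rw [integral_norm_dilate_rpow hn hp hf hz₀ hw₀ hr, mul_le_iff_le_one_right hM] at h1
  linarith

theorem fMin_eq_coordinates {n : ℕ} (p : ℝ) (z₀ : CSpace n) (w₀ : ℂ) (z : CSpace n) :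
    fMin p z₀ w₀ z = w₀ * ((1 - ∑ j, (‖z₀ j‖ : ℂ) ^ 2) /
      (1 - ∑ j, z j * (starRingEnd ℂ) (z₀ j))) ^ ((2 * n / p : ℝ) : ℂ) := by
  have h : (‖z₀‖ : ℂ) ^ 2 = ∑ j, (‖z₀ j‖ : ℂ) ^ 2 := by
    exact_mod_cast congrArg (fun x : ℝ => (x : ℂ)) (EuclideanSpace.norm_sq_eq z₀)
  rw [fMin, h, PiLp.inner_apply]
  rfl

/-- `fMin p z₀ w₀` is the minimal norm interpolant, it is the only one (as a function on the ball),
it is given by the coordinate formula, and its norm is `|w₀| (1 - ‖z₀‖²)^{n/p}`. -/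
theorem theorem4p1 (n : ℕ) (hn : 1 ≤ n) (p : ℝ) (hp : 1 < p)
    (z₀ : CSpace n) (hz₀ : z₀ ∈ Metric.ball (0 : CSpace n) 1) (w₀ : ℂ) :
    IsMinNormInterpolant p z₀ w₀ (fMin p z₀ w₀) ∧
    (∀ f : CSpace n → ℂ, IsMinNormInterpolant p z₀ w₀ f →
      Set.EqOn f (fMin p z₀ w₀) (Metric.ball 0 1)) ∧
    (∀ z ∈ Metric.ball (0 : CSpace n) 1,
      fMin p z₀ w₀ z =
        w₀ * ((1 - ∑ j, (‖z₀ j‖ : ℂ) ^ 2) /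
          (1 - ∑ j, z j * (starRingEnd ℂ) (z₀ j))) ^ ((2 * n / p : ℝ) : ℂ)) ∧
    hardyNorm p (fMin p z₀ w₀) = ENNReal.ofReal (‖w₀‖ * (1 - ‖z₀‖ ^ 2) ^ ((n : ℝ) / p)) := by
  have hz : ‖z₀‖ < 1 := mem_ball_zero_iff.1 hz₀
  have hnorm := hardyNorm_fMin hn hp hz w₀
  have hmem : MemHardy p (fMin p z₀ w₀) :=
    ⟨differentiableOn_fMin p hz w₀ fun x hx => norm_mul_lt_one hz (mem_ball_zero_iff.1 hx).le,
      hnorm ▸ ENNReal.ofReal_lt_top⟩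
  refine ⟨⟨hmem, fMin_self p hz w₀, fun g hg hgz => ?_⟩, fun f hf x hx => ?_,
    fun z _ => fMin_eq_coordinates p z₀ w₀ z, hnorm⟩
  · rw [hnorm]
    exact ofReal_extremal_value_le_hardyNorm hn hp hg.1 hz hgz
  · have hle := hf.2.2 _ hmem (fMin_self p hz w₀)
    rw [hnorm] at hle
    have hx1 : ‖x‖ < 1 := mem_ball_zero_iff.1 hx
    rcases eq_or_ne w₀ 0 with rfl | hw₀
    · rw [eq_zero_of_hardyNorm_eq_zero hn hp hf.1.1 (by simpa using hle) hx1]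
      simp [fMin]
    · exact eq_fMin_of_hardyNorm_le hn hp hf.1.1 hz hw₀ hf.2.1 hle hx1
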